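/- Let $\mathcal A=(\mathcal A,\preccurlyeq,\to)$ be an implicative algebra with separator $\mathscr S$: $(\mathcal A,\preccurlyeq)$ is a complete lattice, $\to$ is antitone in its first and monotone in its second argument with $a\to\bigwedge B=\bigwedge_{b\in B}(a\to b)$ for all $a\in\mathcal A$, $B\subseteq\mathcal A$, and $\mathscr S\subseteq\mathcal A$ is upwards closed, closed under modus ponens, and contains $\bigwedge_{a,b}(a\to b\to a)$ and $\bigwedge_{a,b,c}((a\to b\to c)\to(a\to b)\to a\to c)$. For families $u,v:X\to\mathcal A$ write $u\sqsubseteq_X v$ if $\bigwedge_{x\in X}(u_x\to v_x)\in\mathscr S$, and $u\cong_X v$ if $u\sqsubseteq_X v$ and $v\sqsubseteq_X u$. Put $a\sqcap b:=\bigwedge_{c}((a\to b\to c)\to c)$ and, for $U\subseteq\mathcal A$, $\exists U:=\bigwedge_{c}\big((\bigwedge_{u\in U}(u\to c))\to c\big)$. Let $\mathbf{Asm}_{\mathcal A}$ be the category of assemblies: its objects are sets $X$ equipped with a map $\exists_X:X\to\mathscr S$, and its morphisms $X\to Y$ are the maps $f$ with $\exists_X\sqsubseteq_X \exists_Y\circ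 f$. For $M\subseteq\mathscr S$ let $\mathbf{Asm}_M$ be its full subcategory of assemblies with $\exists_X$ valued in $M$. An $M$-valuation of $X$ is a map $\nu$ from $X$ to the non-empty subsets of $M$, and $\exists\nu$ denotes the family $(\exists(\nu(x)))_{x\in X}$. The set $M$ is * algebraic if it is closed under $\sqcap$; * dense if it is non-empty and there is an $M$-valuation $\nu$ of $\mathscr S$ with $\mathrm{id}_{\mathscr S}\cong_{\mathscr S}\exists\nu$; * compact if for every set $X$, every $u:X\to M$ and every $M$-valuation $\nu$ of $X$ with $u\sqsubseteq_X\exists\nu$ there is $b:X\to M$ with $b_x\in\nu(x)$ for all $x$ and $u\sqsubseteq_X b\sqsubseteq_X\exists\nu$; * a generator if it is algebraic, dense and compact. The regular completion $(\mathbf{Asm}_M)_{\mathrm{reg}/\mathrm{lex}}$ has the morphisms of $\mathbf{Asm}_M$ as objects; a morphism from $f:X\to Y$ to $f':X'\to Y'$ is an equivalence class $[l]$ of morphisms $l:X\to X'$ such that $f'\circ l$ coequalises the kernel pair of $f$, with $[l_1]=[l_2]$ iff $f'l_1=f'l_2$. One says that $\mathbf{Asm}_{\mathcal A}$ is the regular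 completion of $\mathbf{Asm}_M$ if the functor $(\mathbf{Asm}_M)_{\mathrm{reg}/\mathrm{lex}}\to\mathbf{Asm}_{\mathcal A}$, $f\mapsto \mathrm{Im}(f)$, $[l]\mapsto([x]\mapsto[l(x)])$, is an equivalence, where for $f:X\to Y$ the assembly $\mathrm{Im}(f)$ has as elements the classes $[x]=f^{-1}(f(x))$, with $\exists_{\mathrm{Im}(f)}([x])=\exists\{\exists_X(x')\mid x'\in[x]\}$. **Corollary.** Let $M\subseteq\mathscr S$ be algebraic, and suppose that $M$ is a generator or that $\mathbf{Asm}_{\mathcal A}$ is the regular completion of $\mathbf{Asm}_M$. Then the closure of $\mathbf{Asm}_M$ under isomorphisms in $\mathbf{Asm}_{\mathcal A}$ is exactly the full subcategory of $\mathbf{Asm}_{\mathcal A}$ on the projective objects, where $P$ is projective if every morphism $P\to Y$ lifts along every regular epimorphism $E\to Y$. -/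

import Mathlib

open CategoryTheory

universe v u

/-! ### Implicative algebras -/

/-- An implicative structure: a complete lattice with an implication that is antitone in its first
argument, monotone in its second one, and commutes with all meets (the empty one included) in its
second argument. -/
class ImplicativeStructure (A : Type u) extends CompleteLattice A where
  imp : A → A → A
  imp_mono : ∀ {a a' b b' : A}, a' ≤ a → b ≤ b' → imp a b ≤ imp a' b'
  imp_sInf : ∀ (a : A) (B : Set A), imp a (sInf B) = ⨅ b ∈ B, imp a b

infixr:60 " ⇾ " => ImplicativeStructure.imp

/-- An implicative algebra: an implicative structure with a separator `sep`, i.e. an upwards closed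
subset that contains the combinators `K` and `S` and is closed under modus ponens. -/
class ImplicativeAlgebra (A : Type u) extends ImplicativeStructure A where
  sep : Set A
  sep_up : ∀ {a b : A}, a ≤ b → a ∈ sep → b ∈ sep
  sep_K : (⨅ (a : A) (b : A), (a ⇾ b ⇾ a)) ∈ sep
  sep_S : (⨅ (a : A) (b : A) (c : A), ((a ⇾ b ⇾ c) ⇾ (a ⇾ b) ⇾ a ⇾ c)) ∈ sep
  sep_mp : ∀ {a b : A}, (a ⇾ b) ∈ sep → a ∈ sep → b ∈ sep

namespace ImplicativeAlgebra

variable {A : Type u} [ImplicativeAlgebra A]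

/-- The entailment preorder of the fibre of the implicative tripos over `X`. -/
def Entails {X : Type*} (a b : X → A) : Prop := (⨅ x, (a x ⇾ b x)) ∈ (sep : Set A)

/-- Isomorphism in the fibre of the implicative tripos over `X`. -/
def Equivalent {X : Type*} (a b : X → A) : Prop := Entails a b ∧ Entails b a

/-- The product for the entailment preorder: the second-order encoding of pairs. -/
def pair (a b : A) : A := ⨅ c : A, ((a ⇾ b ⇾ c) ⇾ c)

/-- Implicative existence: the second-order encoding of the existential quantification of the
family of all elements of `U`. -/
def ex (U : Set A) : A := ⨅ c : A, ((⨅ u ∈ U, (u ⇾ c)) ⇾ c)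

theorem imp_iInf {ι : Sort*} (a : A) (b : ι → A) : (a ⇾ ⨅ i, b i) = ⨅ i, (a ⇾ b i) := by
  rw [iInf, ImplicativeStructure.imp_sInf, iInf_range]

theorem sep_K_family {X : Type*} (a b : X → A) : (⨅ x, (a x ⇾ b x ⇾ a x)) ∈ (sep : Set A) :=
  sep_up (le_iInf fun x => (iInf_le _ (a x)).trans (iInf_le _ (b x))) sep_K

/-- The rule of application, for families. -/
theorem sep_app {X : Type*} {a b c : X → A} (h : Entails a (fun x => b x ⇾ c x))
    (h' : Entails a b) : Entails a c := by
  refine sep_mp (sep_mp (sep_up ?_ (sep_S (A := A))) h) h'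
  rw [imp_iInf, imp_iInf]
  refine le_iInf fun x => ((iInf_le _ (a x)).trans ((iInf_le _ (b x)).trans
    (iInf_le _ (c x)))).trans ?_
  exact ImplicativeStructure.imp_mono (iInf_le _ x)
    (ImplicativeStructure.imp_mono (iInf_le _ x) le_rfl)

/-- A constant (uniform) realizer is entailed by everything. -/
theorem Entails.const {X : Type*} (a : X → A) {b : X → A} (h : (⨅ x, b x) ∈ (sep : Set A)) :
    Entails a b := by
  refine sep_mp (sep_up ?_ (sep_K (A := A))) h
  rw [imp_iInf]
  exact le_iInf fun x => ((iInf_le _ (⨅ x, b x)).trans (iInf_le _ (a x))).trans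
    (ImplicativeStructure.imp_mono le_rfl (ImplicativeStructure.imp_mono le_rfl (iInf_le _ x)))

theorem Entails.refl {X : Type*} (a : X → A) : Entails a a :=
  sep_app (sep_K_family a (fun x => a x ⇾ a x)) (sep_K_family a a)

theorem Entails.trans {X : Type*} {a b c : X → A} (h : Entails a b) (h' : Entails b c) :
    Entails a c :=
  sep_app (Entails.const a h') h

theorem Entails.comp {X Y : Type*} {a b : Y → A} (h : Entails a b) (f : X → Y) :
    Entails (fun x => a (f x)) (fun x => b (f x)) :=
  sep_up (le_iInf fun x => iInf_le _ (f x)) h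

/-- Introduction rule for implicative existence, uniformly in a family. -/
theorem Entails.ex_intro {X : Type*} {e : X → A} {U : X → Set A} (h : ∀ x, e x ∈ U x) :
    Entails e (fun x => ex (U x)) := by
  have h₁ : Entails (fun p : X × A => e p.1) (fun p => (e p.1 ⇾ p.2) ⇾ e p.1) :=
    sep_K_family _ (fun p : X × A => e p.1 ⇾ p.2)
  have h₂ : Entails (fun p : X × A => (e p.1 ⇾ p.2) ⇾ e p.1) (fun p => (e p.1 ⇾ p.2) ⇾ p.2) :=
    sep_mp (sep_up (by
      rw [imp_iInf]
      exact le_iInf fun p => ((iInf_le _ (e p.1 ⇾ p.2)).trans ((iInf_le _ (e p.1)).trans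
        (iInf_le _ p.2))).trans (ImplicativeStructure.imp_mono (iInf_le _ p) le_rfl))
      (sep_S (A := A))) (Entails.refl (fun p : X × A => e p.1 ⇾ p.2))
  refine sep_up (le_iInf fun x => ?_) (h₁.trans h₂)
  simp only [ex, imp_iInf]
  exact le_iInf fun c => (iInf_le _ (x, c)).trans (ImplicativeStructure.imp_mono le_rfl
    (ImplicativeStructure.imp_mono (iInf₂_le _ (h x)) le_rfl))

/-- Elimination rule for implicative existence, uniformly in a family. -/
theorem Entails.ex_elim {X : Type*} {U : X → Set A} {d : X → A} {s : A} (hs : s ∈ (sep : Set A))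
    (h : ∀ x, ∀ e ∈ U x, s ≤ (e ⇾ d x)) : Entails (fun x => ex (U x)) d := by
  have h₁ : Entails (fun x => ex (U x)) (fun x => (⨅ e ∈ U x, (e ⇾ d x)) ⇾ d x) :=
    sep_up (iInf_mono fun x => ImplicativeStructure.imp_mono le_rfl
      (iInf_le (fun c => (⨅ u ∈ U x, (u ⇾ c)) ⇾ c) (d x))) (Entails.refl (fun x => ex (U x)))
  exact sep_app h₁ (Entails.const _
    (sep_up (le_iInf fun x => le_iInf₂ fun e he => h x e he) hs))

theorem ex_mem_sep {U : Set A} {e : A} (he : e ∈ U) (hs : e ∈ (sep : Set A)) :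
    ex U ∈ (sep : Set A) := by
  have h := Entails.ex_intro (X := Unit) (e := fun _ => e) (U := fun _ => U) (fun _ => he)
  exact sep_mp (sep_up (iInf_le _ ()) h) hs

end ImplicativeAlgebra

open ImplicativeAlgebra

/-! ### Assemblies -/

/-- An assembly over `A`: a set with an existence predicate valued in the separator. -/
structure Assembly (A : Type u) [ImplicativeAlgebra A] where
  carrier : Type u
  pred : carrier → A
  pred_mem : ∀ x, pred x ∈ (sep : Set A)

namespace Assembly

variable {A : Type u} [ImplicativeAlgebra A]

/-- A morphism of assemblies is a map of carriers that is tracked. -/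
@[ext]
structure Hom (X Y : Assembly A) where
  toFun : X.carrier → Y.carrier
  tracked : Entails X.pred (fun x => Y.pred (toFun x))

/-- The category of all assemblies over `A`. -/
instance : Category (Assembly A) where
  Hom X Y := Hom X Y
  id X := ⟨id, Entails.refl _⟩
  comp f g := ⟨g.toFun ∘ f.toFun, f.tracked.trans (g.tracked.comp f.toFun)⟩

/-- The assemblies valued in `M`; `Asm_M` is the corresponding full subcategory. -/
def valuedIn (M : Set A) : ObjectProperty (Assembly A) := fun X => ∀ x, X.pred x ∈ M

/-- The category `Asm_M` of `M`-assemblies. -/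
abbrev AsmOf (M : Set A) := (valuedIn M).FullSubcategory

/-- The image of a morphism of assemblies `f : X ⟶ Y`, i.e. the quotient of `X` by the kernel pair
of `f`: its elements are the classes `[x] = f⁻¹ (f x)`, and `[x]` exists as much as some member
of `[x]` does. -/
def image {X Y : Assembly A} (f : X ⟶ Y) : Assembly A where
  carrier := Quotient (Setoid.ker f.toFun)
  pred q := ex {a | ∃ x : X.carrier, Quotient.mk (Setoid.ker f.toFun) x = q ∧ X.pred x = a}
  pred_mem q := by
    obtain ⟨x, rfl⟩ := Quotient.exists_rep q
    exact ex_mem_sep ⟨x, rfl, rfl⟩ (X.pred_mem x)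

/-- The morphism of images induced by a morphism `l` that is compatible with the kernels. -/
def imageMap {X Y X' Y' : Assembly A} (f : X ⟶ Y) (f' : X' ⟶ Y') (l : X ⟶ X')
    (h : ∀ x₁ x₂, f.toFun x₁ = f.toFun x₂ →
      f'.toFun (l.toFun x₁) = f'.toFun (l.toFun x₂)) : image f ⟶ image f' where
  toFun := Quotient.map l.toFun h
  tracked := by
    have h₁ : Entails X.pred (fun x => (image f').pred (Quotient.mk _ (l.toFun x))) :=
      l.tracked.trans (Entails.ex_intro fun x => ⟨l.toFun x, rfl, rfl⟩)
    refine Entails.ex_elim h₁ ?_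
    rintro _ _ ⟨x, rfl, rfl⟩
    exact iInf_le _ x

end Assembly

/-! ### Regular completions -/

/-- The objects of the regular completion of a (lex) category `C`: the morphisms of `C`. -/
structure RegLex (C : Type u) [Category.{v} C] where
  {dom : C}
  {cod : C}
  arr : dom ⟶ cod

namespace RegLex

variable {C : Type u} [Category.{v} C]

/-- The representatives of morphisms from `F` to `G`: the morphisms `l` such that `G.arr ∘ l`
coequalises each parallel pair that `F.arr` coequalises. All such pairs factor through the kernel
pair of `F.arr` whenever the latter exists, so this means that `G.arr ∘ l` coequalises the kernel
pair of `F.arr`. -/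
def PreHom (F G : RegLex C) :=
  {l : F.dom ⟶ G.dom // ∀ ⦃T : C⦄ (a b : T ⟶ F.dom), a ≫ F.arr = b ≫ F.arr →
    a ≫ l ≫ G.arr = b ≫ l ≫ G.arr}

/-- Two representatives are identified if they agree after composition with the target object. -/
instance preHomSetoid (F G : RegLex C) : Setoid (PreHom F G) :=
  Setoid.ker fun l => l.1 ≫ G.arr

/-- The regular completion of a (lex) category. -/
instance : Category (RegLex C) where
  Hom F G := Quotient (preHomSetoid F G)
  id F := Quotient.mk _ ⟨𝟙 _, fun _ a b h => by simpa using h⟩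
  comp {F G H} := Quotient.map₂
    (fun l m => ⟨l.1 ≫ m.1, fun T a b h => by
      simpa using m.2 (a ≫ l.1) (b ≫ l.1) (by simpa using l.2 a b h)⟩)
    (fun l₁ l₂ hl m₁ m₂ hm => by
      have e₁ : l₁.1 ≫ G.arr = l₂.1 ≫ G.arr := hl
      have e₂ : m₁.1 ≫ H.arr = m₂.1 ≫ H.arr := hm
      show (l₁.1 ≫ m₁.1) ≫ H.arr = (l₂.1 ≫ m₂.1) ≫ H.arr
      rw [Category.assoc, Category.assoc, ← e₂]
      exact m₁.2 _ _ e₁)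
  id_comp := by
    rintro F G ⟨l⟩
    exact congrArg (Quotient.mk _) (Subtype.ext (Category.id_comp _))
  comp_id := by
    rintro F G ⟨l⟩
    exact congrArg (Quotient.mk _) (Subtype.ext (Category.comp_id _))
  assoc := by
    rintro F G H I ⟨l⟩ ⟨m⟩ ⟨n⟩
    exact congrArg (Quotient.mk _) (Subtype.ext (Category.assoc _ _ _))

end RegLex

namespace Assembly

variable {A : Type u} [ImplicativeAlgebra A]

theorem compatible_of_preHom {M : Set A} {F G : RegLex (AsmOf M)} (l : RegLex.PreHom F G)
    (x₁ x₂ : F.dom.obj.carrier) (h : F.arr.hom.toFun x₁ = F.arr.hom.toFun x₂) :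
    G.arr.hom.toFun (l.1.hom.toFun x₁) = G.arr.hom.toFun (l.1.hom.toFun x₂) := by
  let T : AsmOf M := ⟨⟨PUnit, fun _ => F.dom.obj.pred x₁, fun _ => F.dom.obj.pred_mem x₁⟩,
    fun _ => F.dom.property x₁⟩
  have tr : ∀ x, Entails (fun _ : PUnit.{u + 1} => F.dom.obj.pred x₁)
      (fun _ => F.dom.obj.pred x) := fun x =>
    Entails.const _ (sep_up (le_iInf fun _ => le_rfl) (F.dom.obj.pred_mem x))
  let pt : F.dom.obj.carrier → (T ⟶ F.dom) := fun x =>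
    ObjectProperty.homMk (⟨fun _ => x, tr x⟩ : Hom T.obj F.dom.obj)
  have key := l.2 (pt x₁) (pt x₂) (by
    apply ObjectProperty.hom_ext
    apply Hom.ext
    funext _
    exact h)
  exact congrFun (congrArg (fun k : T ⟶ G.cod => k.hom.toFun) key) PUnit.unit

/-- The canonical functor from the regular completion of `Asm_M` to the category of all assemblies:
it maps an object `f` to the image of `f`, and `[l]` to the map `[x] ↦ [l x]` of images. -/
def completionFunctor (M : Set A) : RegLex (AsmOf M) ⥤ Assembly A where
  obj F := image F.arr.hom
  map {F G} := Quotient.lift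
    (fun l => imageMap F.arr.hom G.arr.hom l.1.hom (compatible_of_preHom l))
    (fun l₁ l₂ h => by
      have e : l₁.1 ≫ G.arr = l₂.1 ≫ G.arr := h
      apply Hom.ext
      funext q
      induction q using Quotient.inductionOn with
      | h x =>
        exact Quotient.sound
          (congrFun (congrArg (fun k : F.dom ⟶ G.cod => k.hom.toFun) e) x))
  map_id F := by
    apply Hom.ext
    funext q
    induction q using Quotient.inductionOn with
    | h x => rfl
  map_comp {F G H} f g := by
    induction f using Quotient.inductionOn with
    | h l =>
      induction g using Quotient.inductionOn with
      | h m =>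
        apply Hom.ext
        funext q
        induction q using Quotient.inductionOn with
        | h x => rfl

/-- The category of all assemblies is the regular completion of `Asm_M`. -/
def IsRegularCompletionOf (M : Set A) : Prop := (completionFunctor M).IsEquivalence

end Assembly

/-- The (regular) projective objects of a category: those with the lifting property against all
regular epimorphisms. -/
def regularProjective (C : Type u) [Category.{v} C] : ObjectProperty C := fun P =>
  ∀ ⦃E Y : C⦄ (e : E ⟶ Y) (k : P ⟶ Y), IsRegularEpi e → ∃ l : P ⟶ E, l ≫ e = k

/-! ### Generators -/

section Generators

variable {A : Type u} [ImplicativeAlgebra A]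

/-- Algebraic subsets of the separator. -/
structure IsAlgebraicSubset (M : Set A) : Prop where
  subset_sep : M ⊆ sep
  pair_mem : ∀ {a b : A}, a ∈ M → b ∈ M → pair a b ∈ M

/-- An `M`-valuation of `X`: a map from `X` to the non-empty subsets of `M`. -/
def IsValuation (M : Set A) {X : Type u} (ν : X → Set A) : Prop :=
  ∀ x, ν x ⊆ M ∧ (ν x).Nonempty

/-- `M` is dense in the separator. -/
def IsDenseSubset (M : Set A) : Prop :=
  M.Nonempty ∧ ∃ ν : ↥(sep : Set A) → Set A, IsValuation M ν ∧
    Equivalent (fun s : ↥(sep : Set A) => (s : A)) (fun s => ex (ν s))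

/-- `M` is compact. -/
def IsCompactSubset (M : Set A) : Prop :=
  ∀ (X : Type u) (a : X → A) (ν : X → Set A), (∀ x, a x ∈ M) → IsValuation M ν →
    Entails a (fun x => ex (ν x)) →
    ∃ b : X → A, (∀ x, b x ∈ M) ∧ (∀ x, b x ∈ ν x) ∧
      Entails a b ∧ Entails b (fun x => ex (ν x))

/-- A generator: an algebraic subset of the separator that is dense and compact. -/
structure IsGenerator (M : Set A) : Prop extends IsAlgebraicSubset M where
  dense : IsDenseSubset M
  compact : IsCompactSubset M

end Generators

/-! ### Uniform rules for pairs and existentials -/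

namespace ImplicativeAlgebra

variable {A : Type u} [ImplicativeAlgebra A]

/-! Two facts suffice: every `M`-assembly is projective, and every assembly is a regular quotient of
an `M`-assembly. A projective object is then a retract of an `M`-assembly, and pulling the predicate
back along the section makes it isomorphic to an `M`-assembly (`isoClosure_of_retract`). Regular
epimorphisms are the surjections `f : X ⟶ Y` for which `Y.pred y` uniformly entails the existential
over the fibre of `y`. For a generator, density therefore gives the covers, and compactness chooses
lifts in a tracked way. For a regular completion, every assembly is an image, hence covered by a
domain in `Asm_M`; regular epimorphisms between images split on representatives
(`exists_section_of_strongEpi`), which gives the lifts. -/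

theorem Entails.pair_fst {X : Type*} (a b : X → A) : Entails (fun x => pair (a x) (b x)) a :=
  sep_app (b := fun x => a x ⇾ b x ⇾ a x)
    (sep_up (iInf_mono fun x => ImplicativeStructure.imp_mono le_rfl
      (iInf_le (fun c => (a x ⇾ b x ⇾ c) ⇾ c) (a x))) (Entails.refl _))
    (Entails.const _ (sep_K_family a b))

theorem Entails.pair_snd {X : Type*} (a b : X → A) : Entails (fun x => pair (a x) (b x)) b :=
  sep_app (b := fun x => a x ⇾ b x ⇾ b x)
    (sep_up (iInf_mono fun x => ImplicativeStructure.imp_mono le_rfl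
      (iInf_le (fun c => (a x ⇾ b x ⇾ c) ⇾ c) (b x))) (Entails.refl _))
    (Entails.const _ (Entails.const a (Entails.refl b)))

theorem pair_mem_sep {a b : A} (ha : a ∈ (sep : Set A)) (hb : b ∈ (sep : Set A)) :
    pair a b ∈ (sep : Set A) :=
  -- By definition, `pair a b` is the realizer of this entailment over all `c`.
  have h : Entails (fun c : A => a ⇾ b ⇾ c) (fun c => c) :=
    sep_app (sep_app (Entails.refl _)
      (Entails.const _ (sep_up (le_iInf fun _ => le_rfl) ha)))
      (Entails.const _ (sep_up (le_iInf fun _ => le_rfl) hb))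
  h

theorem Entails.ex_mono {X : Type*} {U V : X → Set A} (h : ∀ x, U x ⊆ V x) :
    Entails (fun x => ex (U x)) (fun x => ex (V x)) :=
  sep_up (iInf_mono fun x => ImplicativeStructure.imp_mono le_rfl
    (iInf_mono fun _ => ImplicativeStructure.imp_mono
      (le_iInf₂ fun u hu => iInf₂_le u (h x hu)) le_rfl)) (Entails.refl fun x => ex (U x))

/-- Elimination of an existential over the fibres of a relation `R`, uniformly in a family. -/
theorem Entails.ex_rel_elim {X Y : Type*} {R : X → Y → Prop} {e : Y → A} {d : X → A}
    (h : Entails (fun q : {q : X × Y // R q.1 q.2} => e q.1.2) (fun q => d q.1.1)) :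
    Entails (fun x => ex {a | ∃ y, R x y ∧ e y = a}) d := by
  refine Entails.ex_elim h ?_
  rintro x _ ⟨y, hy, rfl⟩
  exact iInf_le (fun q : {q : X × Y // R q.1 q.2} => e q.1.2 ⇾ d q.1.1) ⟨(x, y), hy⟩

end ImplicativeAlgebra

/-! ### Images and regular epimorphisms -/

namespace Assembly

variable {A : Type u} [ImplicativeAlgebra A]

theorem mono_of_injective {X Y : Assembly A} (f : X ⟶ Y) (hf : Function.Injective f.toFun) :
    Mono f where
  right_cancellation g h e := by
    apply Hom.ext
    funext x
    exact hf (congrFun (congrArg Hom.toFun e) x)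

/-- The canonical projection onto the image. -/
def imageProj {X Y : Assembly A} (f : X ⟶ Y) : X ⟶ image f where
  toFun := Quotient.mk (Setoid.ker f.toFun)
  tracked := Entails.ex_intro fun x => ⟨x, rfl, rfl⟩

/-- The canonical inclusion of the image. -/
def imageIncl {X Y : Assembly A} (f : X ⟶ Y) : image f ⟶ Y where
  toFun := Quotient.lift f.toFun fun _ _ h => h
  tracked := by
    refine Entails.ex_elim f.tracked ?_
    rintro _ _ ⟨x, rfl, rfl⟩
    exact iInf_le _ x

theorem imageProj_incl {X Y : Assembly A} (f : X ⟶ Y) : imageProj f ≫ imageIncl f = f := rfl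

instance {X Y : Assembly A} (f : X ⟶ Y) : Mono (imageIncl f) :=
  mono_of_injective _ (by
    rintro ⟨x⟩ ⟨y⟩ h
    exact Quotient.sound h)

/-- The assembly of pairs that are identified by `f`. -/
def kernelPair {X Y : Assembly A} (f : X ⟶ Y) : Assembly A where
  carrier := {p : X.carrier × X.carrier // f.toFun p.1 = f.toFun p.2}
  pred p := pair (X.pred p.1.1) (X.pred p.1.2)
  pred_mem _ := pair_mem_sep (X.pred_mem _) (X.pred_mem _)

def kernelPairFst {X Y : Assembly A} (f : X ⟶ Y) : kernelPair f ⟶ X :=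
  ⟨fun p => p.1.1, Entails.pair_fst _ _⟩

def kernelPairSnd {X Y : Assembly A} (f : X ⟶ Y) : kernelPair f ⟶ X :=
  ⟨fun p => p.1.2, Entails.pair_snd _ _⟩

theorem kernelPair_condition {X Y : Assembly A} (f : X ⟶ Y) :
    kernelPairFst f ≫ f = kernelPairSnd f ≫ f := by
  apply Hom.ext
  exact funext Subtype.property

/-- A surjection whose target exists only as much as the members of its fibres is a regular
epimorphism. -/
theorem isRegularEpi_of_entails {X Y : Assembly A} (f : X ⟶ Y)
    (hf : Function.Surjective f.toFun)
    (h : Entails Y.pred (fun y => ex {a | ∃ x, f.toFun x = y ∧ X.pred x = a})) :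
    IsRegularEpi f := by
  refine ⟨⟨⟨kernelPair f, kernelPairFst f, kernelPairSnd f, kernelPair_condition f,
    Limits.Cofork.IsColimit.mk' _ fun s => ?_⟩⟩⟩
  have hs : ∀ x₁ x₂, f.toFun x₁ = f.toFun x₂ → s.π.toFun x₁ = s.π.toFun x₂ := fun x₁ x₂ e =>
    congrFun (congrArg Hom.toFun s.condition)
      (⟨(x₁, x₂), e⟩ : {p : X.carrier × X.carrier // f.toFun p.1 = f.toFun p.2})
  have hd : ∀ x, s.π.toFun (Function.surjInv hf (f.toFun x)) = s.π.toFun x := fun x =>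
    hs _ _ (Function.surjInv_eq hf _)
  -- The chosen preimages need not be tracked: `s.π` is constant on fibres, so its tracking
  -- eliminates the existential supplied by `h`.
  refine ⟨⟨fun y => s.π.toFun (Function.surjInv hf y), h.trans ?_⟩, ?_, ?_⟩
  · refine Entails.ex_elim s.π.tracked ?_
    rintro _ _ ⟨x, rfl, rfl⟩
    dsimp only
    rw [hd]
    exact iInf_le (fun x => X.pred x ⇾ s.pt.pred (s.π.toFun x)) x
  · apply Hom.ext
    funext x
    exact hd x
  · intro m hm
    apply Hom.ext
    funext y
    obtain ⟨x, rfl⟩ := hf y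
    exact (congrFun (congrArg Hom.toFun hm) x).trans (hd x).symm

theorem isRegularEpi_imageProj {X Y : Assembly A} (f : X ⟶ Y) : IsRegularEpi (imageProj f) :=
  isRegularEpi_of_entails _ Quotient.mk_surjective (Entails.refl _)

/-- Regular epimorphisms are strong, so the second factor of `f` is both a strong epimorphism and a
monomorphism. -/
theorem isIso_imageIncl {X Y : Assembly A} (f : X ⟶ Y) (hf : IsRegularEpi f) :
    IsIso (imageIncl f) := by
  have : StrongEpi (imageProj f ≫ imageIncl f) := by
    rw [imageProj_incl]
    infer_instance
  have := strongEpi_of_strongEpi (imageProj f) (imageIncl f)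
  exact isIso_of_mono_of_strongEpi _

theorem surjective_of_isRegularEpi {X Y : Assembly A} (f : X ⟶ Y) (hf : IsRegularEpi f) :
    Function.Surjective f.toFun := fun y => by
  have := isIso_imageIncl f hf
  obtain ⟨x, hx⟩ := Quotient.exists_rep ((inv (imageIncl f)).toFun y)
  have e := congrFun (congrArg Hom.toFun (IsIso.inv_hom_id (imageIncl f))) y
  refine ⟨x, Eq.trans ?_ e⟩
  exact congrArg (imageIncl f).toFun hx

/-- This is the tracking of the inverse of `imageIncl f`. -/
theorem entails_of_isRegularEpi {X Y : Assembly A} (f : X ⟶ Y) (hf : IsRegularEpi f) :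
    Entails Y.pred (fun y => ex {a | ∃ x, f.toFun x = y ∧ X.pred x = a}) := by
  have := isIso_imageIncl f hf
  refine (inv (imageIncl f)).tracked.trans (Entails.ex_mono fun y => ?_)
  rintro _ ⟨x, hx, rfl⟩
  refine ⟨x, ?_, rfl⟩
  exact (congrArg (imageIncl f).toFun hx).trans
    (congrFun (congrArg Hom.toFun (IsIso.inv_hom_id (imageIncl f))) y)

/-- A retract of an `M`-assembly is isomorphic to an `M`-assembly. -/
theorem isoClosure_of_retract {M : Set A} {P E : Assembly A} (hE : valuedIn M E) (s : P ⟶ E)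
    (r : E ⟶ P) (h : s ≫ r = 𝟙 P) : (valuedIn M).isoClosure P := by
  have hx : ∀ x, r.toFun (s.toFun x) = x := congrFun (congrArg Hom.toFun h)
  have tr : Entails (fun x => E.pred (s.toFun x)) P.pred := by
    simpa only [hx] using r.tracked.comp s.toFun
  -- The identity map is tracked by `s` in one direction and by `r` in the other.
  let Q : Assembly A := ⟨P.carrier, fun x => E.pred (s.toFun x), fun _ => E.pred_mem _⟩
  exact ⟨Q, fun x => hE _, ⟨⟨⟨id, s.tracked⟩, ⟨id, tr⟩, rfl, rfl⟩⟩⟩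

theorem isoClosure_eq_regularProjective {M : Set A}
    (proj : valuedIn M ≤ regularProjective (Assembly A))
    (cover : ∀ Y : Assembly A, ∃ (E : Assembly A) (e : E ⟶ Y), valuedIn M E ∧ IsRegularEpi e) :
    (valuedIn M).isoClosure = regularProjective (Assembly A) := by
  apply le_antisymm
  · rintro P ⟨Q, hQ, ⟨i⟩⟩ E Y e k he
    obtain ⟨l, hl⟩ := proj Q hQ e (i.inv ≫ k) he
    exact ⟨i.hom ≫ l, by rw [Category.assoc, hl, Iso.hom_inv_id_assoc]⟩
  · intro P hP
    obtain ⟨E, e, hE, he⟩ := cover P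
    obtain ⟨s, hs⟩ := hP e (𝟙 P) he
    exact isoClosure_of_retract hE s e hs

/-! ### Generators: covers and lifts -/

theorem exists_cover_of_dense {M : Set A} (hM : M ⊆ sep) (hd : IsDenseSubset M)
    (Y : Assembly A) : ∃ (E : Assembly A) (e : E ⟶ Y), valuedIn M E ∧ IsRegularEpi e := by
  obtain ⟨-, ν, hν, h₁, h₂⟩ := hd
  let p : Y.carrier → ↥(sep : Set A) := fun y => ⟨Y.pred y, Y.pred_mem y⟩
  -- A point of the cover is a `y` together with a witness in `M` of its existence.
  let E : Assembly A := ⟨{q : Y.carrier × A // q.2 ∈ ν (p q.1)}, fun q => q.1.2,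
    fun q => hM ((hν _).1 q.2)⟩
  let e : E ⟶ Y := ⟨fun q => q.1.1,
    (Entails.ex_intro fun q : E.carrier => q.2).trans (h₂.comp fun q : E.carrier => p q.1.1)⟩
  refine ⟨E, e, fun q => (hν _).1 q.2, isRegularEpi_of_entails e ?_ ?_⟩
  · intro y
    obtain ⟨m, hm⟩ := (hν (p y)).2
    exact ⟨⟨(y, m), hm⟩, rfl⟩
  · exact (h₁.comp p).trans (Entails.ex_mono fun y m hm => ⟨⟨(y, m), hm⟩, rfl, rfl⟩)

theorem regularProjective_of_compact {M : Set A} (hd : IsDenseSubset M)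
    (hc : IsCompactSubset M) : valuedIn M ≤ regularProjective (Assembly A) := by
  intro P hP E Y e k he
  obtain ⟨-, ν, hν, h₁, h₂⟩ := hd
  let p : E.carrier → ↥(sep : Set A) := fun x => ⟨E.pred x, E.pred_mem x⟩
  -- All witnesses of all points over `k z`: selecting one by compactness also selects a lift `x` of
  -- `k z`, tracked through `ν`.
  let W : P.carrier → Set A := fun z => {m | ∃ x, e.toFun x = k.toFun z ∧ m ∈ ν (p x)}
  have hW : IsValuation M W := fun z => by
    refine ⟨?_, ?_⟩
    · rintro m ⟨x, -, hm⟩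
      exact (hν _).1 hm
    · obtain ⟨x, hx⟩ := surjective_of_isRegularEpi e he (k.toFun z)
      obtain ⟨m, hm⟩ := (hν (p x)).2
      exact ⟨m, x, hx, hm⟩
  have hPW : Entails P.pred (fun z => ex (W z)) := by
    refine (k.tracked.trans ((entails_of_isRegularEpi e he).comp k.toFun)).trans
      (Entails.ex_rel_elim (R := fun z x => e.toFun x = k.toFun z) ?_)
    exact (h₁.comp fun q : {q : P.carrier × E.carrier // e.toFun q.2 = k.toFun q.1} =>
      p q.1.2).trans (Entails.ex_mono fun q m hm => ⟨q.1.2, q.2, hm⟩)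
  obtain ⟨b, -, hbW, hb, -⟩ := hc P.carrier P.pred W hP hW hPW
  choose l hl hbl using hbW
  refine ⟨⟨l, hb.trans ((Entails.ex_intro hbl).trans (h₂.comp fun z => p (l z)))⟩, ?_⟩
  apply Hom.ext
  funext z
  exact hl z

/-! ### Regular completions: covers and lifts -/

theorem exists_cover_of_isRegularCompletionOf {M : Set A} (h : IsRegularCompletionOf M)
    (Y : Assembly A) : ∃ (E : Assembly A) (e : E ⟶ Y), valuedIn M E ∧ IsRegularEpi e := by
  have : (completionFunctor M).IsEquivalence := h
  let F := (completionFunctor M).objPreimage Y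
  let i : image F.arr.hom ≅ Y := (completionFunctor M).objObjPreimageIso Y
  have := isRegularEpi_imageProj F.arr.hom
  exact ⟨F.dom.obj, imageProj F.arr.hom ≫ i.hom, F.dom.property,
    (MorphismProperty.cancel_right_of_respectsIso
      (MorphismProperty.regularEpi (Assembly A)) _ i.hom).2 this⟩

/-- In the regular completion, a morphism `[l] : F ⟶ G` that becomes a strong epimorphism of
assemblies is split on the level of representatives. -/
theorem exists_section_of_strongEpi {M : Set A} (h : IsRegularCompletionOf M)
    {F G : RegLex (AsmOf M)} (l : RegLex.PreHom F G)
    (hl : StrongEpi ((completionFunctor M).map (Quotient.mk _ l : F ⟶ G))) :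
    ∃ l' : G.dom ⟶ F.dom, (l' ≫ l.1) ≫ G.arr = G.arr := by
  have : (completionFunctor M).IsEquivalence := h
  -- `H` is the image of `[l]` in the completion: `[l]` factors through it, and its map to `G`
  -- becomes injective. Strength makes that map invertible; a representative of the inverse is the
  -- section.
  let H : RegLex (AsmOf M) := ⟨l.1 ≫ G.arr⟩
  let q : F ⟶ H := Quotient.mk _ ⟨𝟙 _, fun T a b e => by simpa using l.2 a b e⟩
  let m : H ⟶ G := Quotient.mk _ ⟨l.1, fun T a b e => e⟩
  have hqm : q ≫ m = (Quotient.mk _ l : F ⟶ G) :=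
    congrArg (Quotient.mk _) (Subtype.ext (Category.id_comp _))
  have : Mono ((completionFunctor M).map m) := mono_of_injective _ (by
    rintro ⟨x⟩ ⟨y⟩ e
    exact Quotient.sound (@Quotient.exact _ (Setoid.ker G.arr.hom.toFun) _ _ e))
  have : StrongEpi ((completionFunctor M).map q ≫ (completionFunctor M).map m) := by
    rw [← Functor.map_comp, hqm]
    exact hl
  have := strongEpi_of_strongEpi ((completionFunctor M).map q) ((completionFunctor M).map m)
  have := isIso_of_mono_of_strongEpi ((completionFunctor M).map m)
  have := isIso_of_reflects_iso m (completionFunctor M)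
  have hm := IsIso.inv_hom_id m
  obtain ⟨n, hn⟩ := Quotient.exists_rep (inv m)
  rw [← hn] at hm
  exact ⟨n.1, (Quotient.exact hm).trans (Category.id_comp _)⟩

theorem regularProjective_of_isRegularCompletionOf {M : Set A} (h : IsRegularCompletionOf M) :
    valuedIn M ≤ regularProjective (Assembly A) := by
  intro P hP E Y e k he
  have : (completionFunctor M).IsEquivalence := h
  let Φ := completionFunctor M
  let F := Φ.objPreimage E
  let G := Φ.objPreimage Y
  let i : Φ.obj F ≅ E := Φ.objObjPreimageIso E
  let j : Φ.obj G ≅ Y := Φ.objObjPreimageIso Y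
  let Q : AsmOf M := ⟨P, hP⟩
  -- `P` enters the completion as its identity. The kernel of an identity is trivial, so any map out
  -- of `P` represents a morphism from `H`.
  let H : RegLex (AsmOf M) := ⟨𝟙 Q⟩
  let ι : Φ.obj H ⟶ P := imageIncl (𝟙 P)
  let π : P ⟶ Φ.obj H := imageProj (𝟙 P)
  have hπι : π ≫ ι = 𝟙 P := imageProj_incl (𝟙 P)
  obtain ⟨l, hl⟩ := Quotient.exists_rep (Φ.preimage (i.hom ≫ e ≫ j.inv))
  obtain ⟨k', hk⟩ := Quotient.exists_rep (Φ.preimage (ι ≫ k ≫ j.inv))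
  have hl' : Φ.map (Quotient.mk _ l : F ⟶ G) = i.hom ≫ e ≫ j.inv :=
    (congrArg (fun t : F ⟶ G => Φ.map t) hl).trans (Φ.map_preimage _)
  have hk' : Φ.map (Quotient.mk _ k' : H ⟶ G) = ι ≫ k ≫ j.inv :=
    (congrArg (fun t : H ⟶ G => Φ.map t) hk).trans (Φ.map_preimage _)
  obtain ⟨l', hs⟩ := exists_section_of_strongEpi h l (by
    have : StrongEpi (i.hom ≫ e ≫ j.inv) := inferInstance
    rw [← hl'] at this
    exact this)
  let t : H ⟶ F := Quotient.mk _ ⟨k'.1 ≫ l', fun T a b hab => by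
    have : a = b := by simpa [H] using hab
    rw [this]⟩
  have ht : t ≫ (Quotient.mk _ l : F ⟶ G) = Quotient.mk _ k' := Quotient.sound (by
    show ((k'.1 ≫ l') ≫ l.1) ≫ G.arr = k'.1 ≫ G.arr
    rw [Category.assoc, Category.assoc, ← Category.assoc l', hs])
  have hΦ := congrArg (fun t : H ⟶ G => Φ.map t) ht
  rw [Functor.map_comp, hl', hk'] at hΦ
  refine ⟨π ≫ Φ.map t ≫ i.hom, ?_⟩
  rw [← cancel_mono j.inv]
  simp only [Category.assoc]
  rw [hΦ, ← Category.assoc, hπι, Category.id_comp]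

end Assembly

theorem mainTheorem8 {A : Type u} [ImplicativeAlgebra A] (M : Set A) (hM : IsAlgebraicSubset M)
    (h : IsGenerator M ∨ Assembly.IsRegularCompletionOf M) :
    (Assembly.valuedIn M).isoClosure = regularProjective (Assembly A) := by
  rcases h with h | h
  · exact Assembly.isoClosure_eq_regularProjective
      (Assembly.regularProjective_of_compact h.dense h.compact)
      (Assembly.exists_cover_of_dense hM.subset_sep h.dense)
  · exact Assembly.isoClosure_eq_regularProjective
      (Assembly.regularProjective_of_isRegularCompletionOf h)
      (Assembly.exists_cover_of_isRegularCompletionOf h)
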